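/- Let $C$ be a group, let $(G_i)_{i\in I}$ be a family of groups each containing $C$ as a subgroup (via a fixed embedding $C\hookrightarrow G_i$), and let $G=\ast_C G_i$ be the free product of the $G_i$ amalgamated along $C$, with each $G_i$ regarded as a subgroup of $G$. Call a (possibly empty) subset $P$ of a group $A$ a normal subsemigroup of $A$ if it is closed under multiplication and under conjugation by elements of $A$, and for $S\subseteq A$ let $$\mathrm{NSS}_A(S)=\{s_1^{g_1}\cdots s_n^{g_n}\mid n\ge 1,\ s_k\in S,\ g_k\in A\},\qquad s^g:=g^{-1}sg,$$ be the normal subsemigroup of $A$ generated by $S$. For each $i\in I$ let $P_i$ be a normal subsemigroup of $G_i$, and suppose that $P_i\cap C=P_j\cap C$ for all $i,j\in I$. Then, for every $i\in I$, $$G_i\cap \mathrm{NSS}_G\Big(\bigcup_{j\in I}P_j\Big)=P_i .$$ -/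

import Mathlib

/-- A subsemigroup `P` (possibly empty) of a group is normal if it is closed under conjugation. -/
def IsNormalSubsemigroup {A : Type*} [Group A] (P : Subsemigroup A) : Prop :=
  ∀ x ∈ P, ∀ g : A, g⁻¹ * x * g ∈ P

/-- The normal subsemigroup `{s₁^g₁ ⋯ sₙ^gₙ | n ≥ 1, sₖ ∈ S, gₖ ∈ A}` generated by a subset `S` of
a group `A`, where `s^g = g⁻¹ s g`. A pair `(s, g)` in the list stands for the factor `s^g`. -/
def NSS {A : Type*} [Group A] (S : Set A) : Set A :=
  {x | ∃ l : List (A × A), l ≠ [] ∧ (∀ p ∈ l, p.1 ∈ S) ∧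
    x = (l.map fun p => p.2⁻¹ * p.1 * p.2).prod}

/-! Suppose first that each `P i` contains 1. A word is positive if it can be contracted to the
empty word or to a letter of some `P i`. The crux is that positivity depends only on the element
represented (`congr_wordProd`). Contractions only say that a word is positive when some contraction
of it is, so the converse directions are what must be proved: `mul_adjacent`, `erase_one` and
`base_congr`. Normality moves factors from `P i` past other letters, and the compatibility over `C`
transfers them between groups.

Inserting a letter of `P i` preserves positivity, since a neighbour absorbs it. Hence
`positiveFactors`, which is conjugation invariant because its contexts range over the whole group,
contains every `P i` and every product of their conjugates. A one-letter word admits no contraction,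
so `positiveFactors` meets `G i` exactly in `P i`.

In general 1 is adjoined to each `P i`, and the element 1 is treated separately at the end. -/

namespace Monoid.PushoutI

variable {I : Type*} {C : Type*} [Group C] {G : I → Type*} [∀ i, Group (G i)]

/-- Two adjacent letters `x`, `y` can be contracted to the letter `z`: either they lie in the same
group and are multiplied, or one of them is, up to a factor in `P`, an element of the amalgamated
subgroup, which is absorbed by the other one. -/
inductive Contracts (φ : ∀ i, C →* G i) (P : ∀ i, Submonoid (G i)) :
    (Σ i, G i) → (Σ i, G i) → (Σ i, G i) → Prop
  | mul {i : I} (a b : G i) : Contracts φ P ⟨i, a⟩ ⟨i, b⟩ ⟨i, a * b⟩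
  | absorbLeft {i j : I} (p a : G i) (b : G j) (c : C) (hp : p ∈ P i) (ha : a = p * φ i c) :
      Contracts φ P ⟨i, a⟩ ⟨j, b⟩ ⟨j, φ j c * b⟩
  | absorbRight {i j : I} (p a : G i) (b : G j) (c : C) (hp : p ∈ P i) (ha : a = p * φ i c) :
      Contracts φ P ⟨j, b⟩ ⟨i, a⟩ ⟨j, b * φ j c⟩

/-- The words which contractions reduce to the empty word or to a single letter in `P`. -/
inductive PositiveWord (φ : ∀ i, C →* G i) (P : ∀ i, Submonoid (G i)) :
    List (Σ i, G i) → Prop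
  | nil : PositiveWord φ P []
  | single {i : I} (p : G i) (hp : p ∈ P i) : PositiveWord φ P [⟨i, p⟩]
  | contract (u v : List (Σ i, G i)) {x y z : Σ i, G i} (hz : Contracts φ P x y z)
      (h : PositiveWord φ P (u ++ z :: v)) : PositiveWord φ P (u ++ x :: y :: v)

/-! ### Overlaps between marked letters and a contracted pair -/

theorem append_cons_eq_append_pair {α : Type*} {u v u' v' : List α} {m x y : α}
    (h : u ++ m :: v = u' ++ x :: y :: v') :
    (∃ t, u = u' ++ x :: y :: t ∧ v' = t ++ m :: v) ∨ (u = u' ++ [x] ∧ m = y ∧ v = v') ∨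
      (u = u' ∧ m = x ∧ v = y :: v') ∨ (∃ t, u' = u ++ m :: t ∧ v = t ++ x :: y :: v') := by
  rcases List.append_eq_append_iff.1 h with ⟨t, rfl, ht⟩ | ⟨t, rfl, ht⟩
  · rcases t with _ | ⟨a, t⟩ <;> simp_all
  · rcases t with _ | ⟨a, _ | ⟨b, t⟩⟩ <;> simp_all

theorem append_pair_eq_append_pair {α : Type*} {u v u' v' : List α} {m n x y : α}
    (h : u ++ m :: n :: v = u' ++ x :: y :: v') :
    (∃ t, u = u' ++ x :: y :: t ∧ v' = t ++ m :: n :: v) ∨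
      (u = u' ++ [x] ∧ m = y ∧ v' = n :: v) ∨ (u = u' ∧ m = x ∧ n = y ∧ v = v') ∨
      (u' = u ++ [m] ∧ n = x ∧ v = y :: v') ∨
      (∃ t, u' = u ++ m :: n :: t ∧ v = t ++ x :: y :: v') := by
  rcases append_cons_eq_append_pair h with ⟨t, h₁, h₂⟩ | ⟨h₁, h₂, h₃⟩ | ⟨h₁, h₂, h₃⟩ | ⟨t, h₁, h₂⟩
  · exact .inl ⟨t, h₁, h₂⟩
  · exact .inr (.inl ⟨h₁, h₂, h₃.symm⟩)
  · simp_all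
  · rcases t with _ | ⟨a, t⟩ <;> simp_all

/-! ### Stability of positivity under rewriting -/

namespace PositiveWord

variable {φ : ∀ i, C →* G i} {P : ∀ i, Submonoid (G i)}

/-- A relation between letters that is compatible with contractions preserves positivity. -/
theorem of_simulation (T : (Σ i, G i) → (Σ i, G i) → Prop)
    (hmem : ∀ m m', T m m' → m.2 ∈ P m.1 → m'.2 ∈ P m'.1)
    (hleft : ∀ m m' x z, T m m' → Contracts φ P x m z →
      ∃ z', Contracts φ P x m' z' ∧ (z = z' ∨ T z z'))
    (hright : ∀ m m' y z, T m m' → Contracts φ P m y z →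
      ∃ z', Contracts φ P m' y z' ∧ (z = z' ∨ T z z'))
    {u v : List (Σ i, G i)} {m m' : Σ i, G i} (hT : T m m')
    (h : PositiveWord φ P (u ++ m :: v)) : PositiveWord φ P (u ++ m' :: v) := by
  generalize hw : u ++ m :: v = w at h
  induction h generalizing u m v m' with
  | nil => simp at hw
  | @single i p hp =>
    obtain ⟨rfl, rfl, rfl⟩ : u = [] ∧ m = ⟨i, p⟩ ∧ v = [] := by
      rcases u with _ | ⟨a, u⟩ <;> simp_all
    exact single _ (hmem _ _ hT hp)
  | contract u' v' hz h ih =>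
    rcases append_cons_eq_append_pair hw with
      ⟨t, rfl, rfl⟩ | ⟨rfl, rfl, rfl⟩ | ⟨rfl, rfl, rfl⟩ | ⟨t, rfl, rfl⟩
    · simpa using contract _ _ hz (by simpa using ih (u := u' ++ _ :: t) hT (by simp))
    · obtain ⟨z', hz', rfl | hT'⟩ := hleft _ _ _ _ hT hz
      · simpa using contract _ _ hz' h
      · simpa using contract _ _ hz' (ih hT' rfl)
    · obtain ⟨z', hz', rfl | hT'⟩ := hright _ _ _ _ hT hz
      · exact contract _ _ hz' h
      · exact contract _ _ hz' (ih hT' rfl)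
    · simpa using contract (u ++ m' :: t) _ hz (by simpa using ih hT (by simp))

variable (hP : ∀ i, ∀ x ∈ P i, ∀ g : G i, g * x * g⁻¹ ∈ P i)
  (hPC : ∀ i j c, φ i c ∈ P i → φ j c ∈ P j)

include hP in
-- By normality the extra factor survives a contraction: it is conjugated past the neighbour
-- multiplied on its left, or joins the factor in `P i` that an absorption discards.
theorem mul_left {i : I} {p a : G i} (hp : p ∈ P i) {u v : List (Σ i, G i)}
    (h : PositiveWord φ P (u ++ ⟨i, a⟩ :: v)) : PositiveWord φ P (u ++ ⟨i, p * a⟩ :: v) := by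
  refine of_simulation (fun m m' => ∃ (i : I) (a p : G i), p ∈ P i ∧ m = ⟨i, a⟩ ∧ m' = ⟨i, p * a⟩)
    ?_ ?_ ?_ ⟨i, a, p, hp, rfl, rfl⟩ h
  · rintro _ _ ⟨i, a, p, hp, rfl, rfl⟩ ha
    exact mul_mem hp ha
  · rintro _ _ x z ⟨i, a, p, hp, rfl, rfl⟩ hz
    cases hz with
    | mul b =>
      exact ⟨_, .mul _ _, .inr ⟨i, b * a, b * p * b⁻¹, hP i p hp b, rfl, by simp [mul_assoc]⟩⟩
    | absorbLeft q b _ c hq hb =>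
      exact ⟨_, .absorbLeft q b _ c hq hb,
        .inr ⟨i, φ i c * a, φ i c * p * (φ i c)⁻¹, hP i p hp _, rfl, by simp [mul_assoc]⟩⟩
    | absorbRight q _ b c hq hb =>
      exact ⟨_, .absorbRight (p * q) _ b c (mul_mem hp hq) (by simp [hb, mul_assoc]), .inl rfl⟩
  · rintro _ _ x z ⟨i, a, p, hp, rfl, rfl⟩ hz
    cases hz with
    | mul _ b => exact ⟨_, .mul _ _, .inr ⟨i, a * b, p, hp, rfl, by simp [mul_assoc]⟩⟩
    | absorbLeft q _ b c hq hb =>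
      exact ⟨_, .absorbLeft (p * q) _ b c (mul_mem hp hq) (by simp [hb, mul_assoc]), .inl rfl⟩
    | absorbRight q b _ c hq hb =>
      exact ⟨_, .absorbRight q b _ c hq hb, .inr ⟨i, a * φ i c, p, hp, rfl, by simp [mul_assoc]⟩⟩

include hP in
theorem mul_right {i : I} {p a : G i} (hp : p ∈ P i) {u v : List (Σ i, G i)}
    (h : PositiveWord φ P (u ++ ⟨i, a⟩ :: v)) : PositiveWord φ P (u ++ ⟨i, a * p⟩ :: v) := by
  simpa using mul_left hP (hP i p hp a) h

include hPC in
theorem base_congr {i j : I} (c : C) {u v : List (Σ i, G i)}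
    (h : PositiveWord φ P (u ++ ⟨i, φ i c⟩ :: v)) : PositiveWord φ P (u ++ ⟨j, φ j c⟩ :: v) := by
  refine of_simulation (fun m m' => ∃ (i j : I) (a : G i) (c : C), a = φ i c ∧ m = ⟨i, a⟩ ∧
    m' = ⟨j, φ j c⟩) ?_ ?_ ?_ ⟨i, j, _, c, rfl, rfl, rfl⟩ h
  · rintro _ _ ⟨i, j, a, c, rfl, rfl, rfl⟩ ha
    exact hPC _ _ _ ha
  · rintro _ _ x z ⟨i, j, a, c, ha, rfl, rfl⟩ hz
    cases hz with
    | mul b => exact ⟨_, .absorbRight 1 _ b c (one_mem _) (one_mul _).symm, .inl (by rw [ha])⟩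
    | absorbLeft q b _ d hq hb =>
      exact ⟨_, .absorbLeft q b _ d hq hb, .inr ⟨i, j, _, d * c, by simp [ha], rfl, by simp⟩⟩
    | absorbRight q _ b d hq hb =>
      -- When a base letter is itself absorbed, its discarded factor lies in the base, so `hPC`
      -- carries it over to `P j`.
      have hq' : q = φ i (c * d⁻¹) := by simp [eq_mul_inv_iff_mul_eq, ← hb, ha]
      exact ⟨_, .absorbRight (φ j (c * d⁻¹)) _ b d (hPC i j _ (hq' ▸ hq)) (by simp), .inl rfl⟩
  · rintro _ _ x z ⟨i, j, a, c, ha, rfl, rfl⟩ hz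
    cases hz with
    | mul _ b => exact ⟨_, .absorbLeft 1 _ b c (one_mem _) (one_mul _).symm, .inl (by rw [ha])⟩
    | absorbLeft q _ b d hq hb =>
      have hq' : q = φ i (c * d⁻¹) := by simp [eq_mul_inv_iff_mul_eq, ← hb, ha]
      exact ⟨_, .absorbLeft (φ j (c * d⁻¹)) _ b d (hPC i j _ (hq' ▸ hq)) (by simp), .inl rfl⟩
    | absorbRight q b _ d hq hb =>
      exact ⟨_, .absorbRight q b _ d hq hb, .inr ⟨i, j, _, c * d, by simp [ha], rfl, by simp⟩⟩

include hP in
/-- A base element can be moved from one letter to the next one. -/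
theorem shift {i j : I} {a : G i} {b : G j} (c : C) {u v : List (Σ i, G i)}
    (h : PositiveWord φ P (u ++ ⟨i, a⟩ :: ⟨j, b⟩ :: v)) :
    PositiveWord φ P (u ++ ⟨i, a * (φ i c)⁻¹⟩ :: ⟨j, φ j c * b⟩ :: v) := by
  generalize hw : u ++ (⟨i, a⟩ : Σ i, G i) :: ⟨j, b⟩ :: v = w at h
  induction h generalizing u v i j a b c with
  | nil => simp at hw
  | single => rcases u with _ | ⟨_, _ | ⟨_, _⟩⟩ <;> simp at hw
  | contract u' v' hz h ih =>
    rcases append_pair_eq_append_pair hw with ⟨t, rfl, rfl⟩ | ⟨rfl, rfl, rfl⟩ |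
      ⟨rfl, rfl, rfl, rfl⟩ | ⟨rfl, rfl, rfl⟩ | ⟨t, rfl, rfl⟩
    · simpa using contract _ _ hz (by simpa using ih (u := u' ++ _ :: t) c (by simp))
    · simp only [List.append_assoc, List.singleton_append]
      cases hz with
      | mul x => exact contract _ _ (.mul _ _) (by simpa [mul_assoc] using ih c rfl)
      | absorbLeft q x _ d hq hx =>
        exact contract _ _ (.absorbLeft q x _ d hq hx) (by simpa [mul_assoc] using ih c rfl)
      | absorbRight q _ x d hq ha =>
        exact contract _ _ (.absorbRight q _ x (d * c⁻¹) hq (by simp [ha, mul_assoc]))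
          (by simpa [mul_assoc] using ih c rfl)
    · cases hz with
      | mul a b =>
        exact contract u v (.mul (a * (φ i c)⁻¹) (φ i c * b)) (by simpa [mul_assoc] using h)
      | absorbLeft q _ _ d hq ha =>
        exact contract _ _ (.absorbLeft q _ _ (d * c⁻¹) hq (by simp [ha, mul_assoc]))
          (by simpa [mul_assoc] using h)
      | absorbRight q _ _ d hq hb =>
        -- The discarded factor gets conjugated by `c`; the base part `c * d` cancels the `c⁻¹` put
        -- on the left letter.
        exact contract _ _ (.absorbRight (φ j c * q * (φ j c)⁻¹) _ _ (c * d) (hP _ _ hq _)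
          (by simp [hb, mul_assoc])) (by simpa [mul_assoc] using h)
    · cases hz with
      | mul _ y =>
        have := ih (u := u) (v := v') c (List.append_cons u _ _)
        rw [List.append_cons] at this ⊢
        exact contract _ v' (.mul (φ j c * b) y) (by simpa only [mul_assoc] using this)
      | absorbLeft q _ y d hq hb =>
        have := ih (u := u) (v := v') c (List.append_cons u _ _)
        rw [List.append_cons] at this ⊢
        exact contract _ v' (.absorbLeft (φ j c * q * (φ j c)⁻¹) (φ j c * b) y (c * d)
          (hP _ _ hq _) (by simp [hb, mul_assoc]))
          (by simpa only [map_mul, mul_assoc] using this)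
      | absorbRight q y _ d hq hy =>
        have := ih (u := u) (v := v') c (List.append_cons u _ _)
        rw [List.append_cons] at this ⊢
        exact contract _ v' (.absorbRight q y (φ j c * b) d hq hy)
          (by simpa only [mul_assoc] using this)
    · simpa using contract (u ++ ⟨i, a * (φ i c)⁻¹⟩ :: ⟨j, φ j c * b⟩ :: t) _ hz
        (by simpa using ih c (by simp))

include hP in
-- This is the converse of contracting by multiplication. The delicate case is a letter absorbed by
-- its outer neighbour: `shift` brings the base part back across, and normality restores the
-- discarded factor.
theorem mul_adjacent {i : I} {a b : G i} {u v : List (Σ i, G i)}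
    (h : PositiveWord φ P (u ++ ⟨i, a⟩ :: ⟨i, b⟩ :: v)) :
    PositiveWord φ P (u ++ ⟨i, a * b⟩ :: v) := by
  generalize hw : u ++ (⟨i, a⟩ : Σ i, G i) :: ⟨i, b⟩ :: v = w at h
  induction h generalizing u v i a b with
  | nil => simp at hw
  | single => rcases u with _ | ⟨_, _ | ⟨_, _⟩⟩ <;> simp at hw
  | contract u' v' hz h ih =>
    rcases append_pair_eq_append_pair hw with ⟨t, rfl, rfl⟩ | ⟨rfl, rfl, rfl⟩ |
      ⟨rfl, hx, hy, rfl⟩ | ⟨rfl, rfl, rfl⟩ | ⟨t, rfl, rfl⟩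
    · simpa using contract _ _ hz (by simpa using ih (u := u' ++ _ :: t) (by simp))
    · simp only [List.append_assoc, List.singleton_append]
      cases hz with
      | mul x => exact contract _ _ (.mul _ _) (by simpa [mul_assoc] using ih rfl)
      | absorbLeft q x _ d hq hx =>
        exact contract _ _ (.absorbLeft q x _ d hq hx) (by simpa [mul_assoc] using ih rfl)
      | absorbRight q _ x d hq ha =>
        have := mul_left hP (u := u' ++ [_]) hq (by simpa using shift hP d h)
        simpa [ha, mul_assoc] using this
    · subst hx
      generalize hm : (⟨i, b⟩ : Σ i, G i) = m at hy
      subst hy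
      cases hz with
      | mul =>
        cases hm
        exact h
      | absorbLeft q _ _ d hq ha =>
        cases hm
        simpa [ha, mul_assoc] using mul_left hP hq h
      | absorbRight q _ _ d hq hb =>
        cases hm
        simpa [hb, mul_assoc] using mul_right hP (hP _ _ hq (φ i d)⁻¹) h
    · cases hz with
      | mul _ y =>
        simpa [mul_assoc] using contract u v' (.mul (a * b) y)
          (by simpa [mul_assoc] using ih (u := u) (v := v') (List.append_cons u _ _))
      | absorbLeft q _ y d hq hb =>
        have := shift hP (i := i) d⁻¹ (u := u) (by simpa using h)
        have := mul_right hP (hP _ _ hq (φ i d)⁻¹) this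
        simpa [hb, mul_assoc] using this
      | absorbRight q y _ d hq hy =>
        simpa [mul_assoc] using contract u v' (.absorbRight q y (a * b) d hq hy)
          (by simpa [mul_assoc] using ih (u := u) (v := v') (List.append_cons u _ _))
    · simpa using contract (u ++ ⟨i, a * b⟩ :: t) _ hz (by simpa using ih (by simp))

theorem insert {i : I} {p : G i} (hp : p ∈ P i) {u v : List (Σ i, G i)}
    (h : PositiveWord φ P (u ++ v)) : PositiveWord φ P (u ++ ⟨i, p⟩ :: v) := by
  rcases v with _ | ⟨⟨j, b⟩, v⟩
  · rcases List.eq_nil_or_concat u with rfl | ⟨u, ⟨j, b⟩, rfl⟩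
    · exact single p hp
    · simpa using contract u [] (.absorbRight p p b 1 hp (by simp)) (by simpa using h)
  · exact contract u v (.absorbLeft p p b 1 hp (by simp)) (by simpa using h)

include hP hPC in
theorem erase_one {i : I} {u v : List (Σ i, G i)}
    (h : PositiveWord φ P (u ++ ⟨i, 1⟩ :: v)) : PositiveWord φ P (u ++ v) := by
  -- If the letter 1 is absorbed as `q * φ i d`, then `φ i d` is the inverse of `q`. So the factor
  -- `φ j d` gained by the neighbour can be cancelled by an element of `P j`.
  have hmem {q : G i} {d : C} (hq : q ∈ P i) (hd : (1 : G i) = q * φ i d) (j : I) :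
      (φ j d)⁻¹ ∈ P j := by
    rw [← map_inv]
    refine hPC i j _ ?_
    rwa [map_inv, ← eq_inv_of_mul_eq_one_left hd.symm]
  generalize hw : u ++ (⟨i, 1⟩ : Σ i, G i) :: v = w at h
  induction h generalizing u v with
  | nil => simp at hw
  | single =>
    rcases u with _ | ⟨a, u⟩ <;> simp_all [nil]
  | contract u' v' hz h ih =>
    rcases append_cons_eq_append_pair hw with
      ⟨t, rfl, rfl⟩ | ⟨rfl, hm, rfl⟩ | ⟨rfl, hm, rfl⟩ | ⟨t, rfl, rfl⟩
    · simpa using contract _ _ hz (by simpa using ih (u := u' ++ _ :: t) (by simp))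
    · simp only [List.append_assoc, List.singleton_append]
      generalize ha : (1 : G i) = a at hm hmem
      subst hm
      cases hz with
      | mul x => simpa [← ha] using h
      | absorbLeft q x _ d hq hx =>
        rw [← ha, mul_one] at h
        simpa [hx] using mul_left hP hq (base_congr hPC d h)
      | @absorbRight _ j q _ x d hq hd => simpa using mul_right hP (hmem hq hd j) h
    · generalize ha : (1 : G i) = a at hm hmem
      subst hm
      cases hz with
      | mul _ x => simpa [← ha] using h
      | @absorbLeft _ j q _ x d hq hd => simpa using mul_left hP (hmem hq hd j) h
      | absorbRight q x _ d hq hx =>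
        rw [← ha, one_mul] at h
        simpa [hx] using mul_left hP hq (base_congr hPC d h)
    · simpa using contract (u ++ t) _ hz (by simpa using ih (by simp))

theorem mem_of_singleton {i : I} {g : G i} (h : PositiveWord φ P [⟨i, g⟩]) : g ∈ P i := by
  generalize hw : [(⟨i, g⟩ : Σ i, G i)] = w at h
  cases h with
  | nil => simp at hw
  | single p hp => cases hw; exact hp
  | contract u v => rcases u with _ | ⟨_, _ | ⟨_, _⟩⟩ <;> simp at hw

/-! ### Positivity as a property of elements of the amalgam -/

variable (φ P) in
/-- The syntactic congruence of the set of positive words. -/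
def syntacticCon : Con (FreeMonoid (Σ i, G i)) where
  r w w' := ∀ u v : FreeMonoid (Σ i, G i),
    PositiveWord φ P (u * w * v).toList ↔ PositiveWord φ P (u * w' * v).toList
  iseqv := ⟨fun _ _ _ => .rfl, fun h u v => (h u v).symm, fun h h' u v => (h u v).trans (h' u v)⟩
  mul' {a b c d} h h' u v := by
    rw [← mul_assoc, mul_assoc _ c, h, ← mul_assoc, h', mul_assoc u]

variable (φ) in
/-- The element of the amalgamated product represented by a word. -/
def wordProd : FreeMonoid (Σ i, G i) →* PushoutI φ :=
  FreeMonoid.lift fun g => of g.1 g.2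

include hP hPC in
-- The rewriting lemmas make letters multiplicative and compatible over `C` modulo the syntactic
-- congruence. The universal property then factors the quotient map through the amalgam.
theorem congr_wordProd [Nonempty I] {w w' : FreeMonoid (Σ i, G i)}
    (h : wordProd φ w = wordProd φ w') :
    PositiveWord φ P w.toList ↔ PositiveWord φ P w'.toList := by
  let κ := syntacticCon φ P
  let f (i : I) : G i →* κ.Quotient :=
    { toFun g := κ.mk' (FreeMonoid.of ⟨i, g⟩)
      map_one' := by
        rw [← map_one κ.mk']
        refine (Con.eq _).2 fun u v => ?_
        simpa using ⟨erase_one hP hPC, insert (one_mem (P i))⟩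
      map_mul' a b := by
        rw [← map_mul κ.mk']
        refine (Con.eq _).2 fun u v => ?_
        simpa using ⟨contract _ _ (.mul a b), mul_adjacent hP⟩ }
  have hf (i : I) : (f i).comp (φ i) = (f (Classical.arbitrary I)).comp (φ _) := by
    ext c
    refine (Con.eq _).2 fun u v => ?_
    simpa using ⟨base_congr hPC c, base_congr hPC c⟩
  have key : (lift f _ hf).comp (wordProd φ) = κ.mk' := by
    ext ⟨i, g⟩
    simp [wordProd, f]
  have := (Con.eq κ).1 <| show κ.mk' w = κ.mk' w' by rw [← key, MonoidHom.comp_apply, h]; rfl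
  simpa using this 1 1

variable (φ) in
theorem wordProd_surjective [Nonempty I] : Function.Surjective (wordProd φ) := by
  intro x
  induction x using PushoutI.induction_on with
  | of i g => exact ⟨FreeMonoid.of ⟨i, g⟩, by simp [wordProd]⟩
  | base c =>
    let i := Classical.arbitrary I
    exact ⟨FreeMonoid.of ⟨i, φ i c⟩, by simp [wordProd, of_apply_eq_base]⟩
  | mul x y hx hy =>
    obtain ⟨⟨w, rfl⟩, w', rfl⟩ := hx, hy
    exact ⟨w * w', map_mul _ _ _⟩

end PositiveWord

open PositiveWord

section

variable (φ : ∀ i, C →* G i) (P : ∀ i, Submonoid (G i))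

/-- The elements of the amalgamated product represented by positive words. -/
def positives : Set (PushoutI φ) :=
  {x | ∃ w : FreeMonoid (Σ i, G i), wordProd φ w = x ∧ PositiveWord φ P w.toList}

/-- The elements of the amalgamated product whose insertion preserves `positives`. -/
def positiveFactors : Submonoid (PushoutI φ) where
  carrier := {x | ∀ y z, y * z ∈ positives φ P → y * x * z ∈ positives φ P}
  one_mem' y z h := by simpa using h
  mul_mem' {a b} ha hb y z h := by
    rw [← mul_assoc, mul_assoc]
    refine ha _ _ ?_
    rw [← mul_assoc]
    exact hb _ _ h

variable {φ P}

theorem conj_mem_positiveFactors {x : PushoutI φ} (hx : x ∈ positiveFactors φ P)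
    (g : PushoutI φ) : g⁻¹ * x * g ∈ positiveFactors φ P := fun y z h => by
  simpa [mul_assoc] using hx (y * g⁻¹) (g * z) (by simpa [mul_assoc] using h)

variable (hP : ∀ i, ∀ x ∈ P i, ∀ g : G i, g * x * g⁻¹ ∈ P i)
  (hPC : ∀ i j c, φ i c ∈ P i → φ j c ∈ P j)

include hP hPC in
theorem of_mem_positiveFactors {i : I} {p : G i} (hp : p ∈ P i) :
    of i p ∈ positiveFactors φ P := by
  have : Nonempty I := ⟨i⟩
  intro y z ⟨w, hw, hpos⟩
  obtain ⟨u, rfl⟩ := wordProd_surjective φ y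
  obtain ⟨v, rfl⟩ := wordProd_surjective φ z
  rw [← map_mul] at hw
  refine ⟨u * FreeMonoid.of ⟨i, p⟩ * v, by simp [wordProd], ?_⟩
  simpa using insert hp (by simpa using (congr_wordProd hP hPC hw).1 hpos)

include hP hPC in
theorem mem_of_of_mem_positiveFactors {i : I} {g : G i} (hg : of i g ∈ positiveFactors φ P) :
    g ∈ P i := by
  have : Nonempty I := ⟨i⟩
  -- The empty word is positive, so inserting the element into it gives a positive element.
  obtain ⟨w, hw, hpos⟩ := hg 1 1 ⟨1, by simp, .nil⟩
  rw [mul_one, one_mul] at hw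
  exact mem_of_singleton <| (congr_wordProd hP hPC (w' := FreeMonoid.of ⟨i, g⟩)
    (by simpa [wordProd] using hw)).1 hpos

end

end Monoid.PushoutI

/-! ### From submonoids to possibly empty subsemigroups -/

/-- Adjoining the identity to a subsemigroup. -/
def Subsemigroup.adjoinOne {A : Type*} [Monoid A] (P : Subsemigroup A) : Submonoid A where
  carrier := {x | x = 1 ∨ x ∈ P}
  one_mem' := .inl rfl
  mul_mem' := by
    rintro a b (rfl | ha) (rfl | hb)
    · simp
    · simp [hb]
    · simp [ha]
    · exact .inr (mul_mem ha hb)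

open Monoid.PushoutI in
theorem theoremT {I : Type*} {C : Type*} [Group C] {G : I → Type*} [∀ i, Group (G i)]
    (φ : ∀ i, C →* G i) (hφ : ∀ i, Function.Injective (φ i))
    (P : ∀ i, Subsemigroup (G i)) (hP : ∀ i, IsNormalSubsemigroup (P i))
    (hPC : ∀ i j, {c : C | φ i c ∈ P i} = {c : C | φ j c ∈ P j}) (i : I) :
    Set.range (Monoid.PushoutI.of (φ := φ) i) ∩
        NSS (⋃ j, (Monoid.PushoutI.of (φ := φ) j) '' (P j : Set (G j))) =
      (Monoid.PushoutI.of (φ := φ) i) '' (P i : Set (G i)) := by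
  have hQ (i) : ∀ x ∈ (P i).adjoinOne, ∀ g : G i, g * x * g⁻¹ ∈ (P i).adjoinOne := by
    rintro x (rfl | hx) g
    · exact .inl (by simp)
    · exact .inr (by simpa using hP i x hx g⁻¹)
  have hC (i j c) (hc : φ i c ∈ P i) : φ j c ∈ P j := by
    have : c ∈ {c : C | φ j c ∈ P j} := hPC i j ▸ hc
    exact this
  have hQC (i j c) : φ i c ∈ (P i).adjoinOne → φ j c ∈ (P j).adjoinOne := by
    rintro (hc | hc)
    · exact .inl (by rw [hφ i (hc.trans (map_one _).symm), map_one])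
    · exact .inr (hC i j c hc)
  have hfactor {s : Monoid.PushoutI φ} (hs : s ∈ ⋃ j, of (φ := φ) j '' (P j : Set (G j)))
      (g : Monoid.PushoutI φ) :
      g⁻¹ * s * g ∈ positiveFactors φ fun i => (P i).adjoinOne := by
    obtain ⟨j, p, hp, rfl⟩ := Set.mem_iUnion.1 hs
    exact conj_mem_positiveFactors (of_mem_positiveFactors hQ hQC (.inr hp)) g
  apply Set.Subset.antisymm
  · rintro _ ⟨⟨g, rfl⟩, l, hl, hlS, hg⟩
    refine ⟨g, ?_, rfl⟩
    obtain rfl | h := mem_of_of_mem_positiveFactors hQ hQC (hg ▸ Submonoid.list_prod_mem _ (by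
      simp only [List.mem_map]
      rintro _ ⟨q, hq, rfl⟩
      exact hfactor (hlS q hq) q.2))
    -- Here a nonempty product of conjugates is 1. The inverse of its first factor is the product of
    -- the others, so `p⁻¹` is again in `positiveFactors`. This forces 1 into `P j`, and thence into
    -- `P i` through `C`.
    · obtain _ | ⟨⟨s, h⟩, l⟩ := l
      · exact absurd rfl hl
      obtain ⟨j, p, hp, rfl⟩ := Set.mem_iUnion.1 (hlS _ List.mem_cons_self)
      have hrest : (l.map fun q => q.2⁻¹ * q.1 * q.2).prod ∈
          positiveFactors φ fun i => (P i).adjoinOne :=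
        Submonoid.list_prod_mem _ (by
          simp only [List.mem_map]
          rintro _ ⟨q, hq, rfl⟩
          exact hfactor (hlS q (List.mem_cons_of_mem _ hq)) q.2)
      have hinv : of j p⁻¹ ∈ positiveFactors φ fun i => (P i).adjoinOne := by
        convert! conj_mem_positiveFactors hrest h⁻¹ using 1
        rw [map_one, List.map_cons, List.prod_cons] at hg
        rw [eq_inv_of_mul_eq_one_right hg.symm]
        simp [mul_assoc]
      have hone : (1 : G j) ∈ P j := by
        obtain h1 | h1 := mem_of_of_mem_positiveFactors hQ hQC hinv
        · rwa [← inv_eq_one.1 h1]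
        · simpa using mul_mem hp h1
      simpa using hC j i 1 (by simpa using hone)
    · exact h
  · rintro _ ⟨p, hp, rfl⟩
    exact ⟨⟨p, rfl⟩, [(of i p, 1)], by simp, by
      simpa using ⟨i, p, hp, rfl⟩, by simp⟩
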